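/- **Theorem (Lower bound for Q-IK).** *Setting.* An infinite-armed bandit instance consists of a prior, i.e. a probability distribution on $[0,1]$ with cumulative distribution function $\mathcal F$, together with, for each $x\in[0,1]$, a reward distribution on $[0,1]$ with mean $x$. The expected rewards $\mu_a$ of the arms $a=0,1,2,\dots$ are independent draws from the prior; given these, the rewards $R_a^t$ ($t$-th sample of arm $a$) are independent across $a$ and $t$, and $R_a^t$ has the reward distribution belonging to $\mu_a$. For $\rho\in(0,1)$ put $\lambda_\rho:=\mathcal F^{-1}(1-\rho)$ with $\mathcal F^{-1}(p):=\sup\{x:\mathcal F(x)\le p\}$; an arm $a$ is $[\epsilon,\rho]$-optimal if $\mu_a\ge\lambda_\rho-\epsilon$. An algorithm may use private randomness (independent of the arms) and adaptively chooses which arm to sample next, when to stop, and which $k$ arms to return, on the basis of its private randomness and the rewards observed so far. Its error probability is the probability that it does not stop or does not return $k$ distinct $[\epsilon,\rho]$-optimal arms. *Statement.* There is an absolute constant $c>0$ such that for every integer $k\ge 1$, every $\rho\in(0,\tfrac12]$, $\epsilon\in(0,\tfrac14)$ and $\delta\in(0,e^{-8}/40)$ there is an infinite-armed bandit instance with the following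 property: every algorithm (even one designed with knowledge of the instance, in particular of $\lambda_\rho$, but not of the realized expected rewards of the arms) whose error probability on this instance is at most $\delta$ takes at least $$c\,\frac{k}{\epsilon^2}\Bigl(\frac1\rho+\log\frac{k}{\delta}\Bigr)$$ samples in expectation, where the expected number of samples may be infinite. -/

import Mathlib

open MeasureTheory ProbabilityTheory
open scoped unitInterval ENNReal

noncomputable section

namespace QuantileBandit

/-- The random environment from which an infinite population of arms is drawn: the expected rewards
of the arms are independent draws from `prior`, a probability measure on `[0,1]`, and an arm with
expected reward `x` yields independent rewards in `[0,1]` with law `reward x`, whose mean is `x`. -/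
structure Population where
  /-- the law of the expected reward of a randomly drawn arm -/
  prior : Measure I
  isProbabilityMeasure_prior : IsProbabilityMeasure prior
  /-- the law of one reward of an arm, given the expected reward of the arm -/
  reward : Kernel I I
  isMarkovKernel_reward : IsMarkovKernel reward
  mean_reward : ∀ x : I, ∫ y, (y : ℝ) ∂(reward x) = (x : ℝ)

attribute [instance] Population.isProbabilityMeasure_prior
attribute [instance] Population.isMarkovKernel_reward

/-- `F⁻¹(p) = sup {x | F x ≤ p}`, where `F` is the cumulative distribution function of the
expected reward of a randomly drawn arm. -/
def Population.invCDF (S : Population) (p : ℝ) : ℝ :=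
  sSup {x : ℝ | cdf (S.prior.map ((↑) : I → ℝ)) x ≤ p}

/-- The threshold `λ_ρ = F⁻¹(1 - ρ)` of the top `ρ` fraction of the arms. -/
def Population.threshold (S : Population) (ρ : ℝ) : ℝ :=
  S.invCDF (1 - ρ)

/-- The joint law of the expected rewards of the arms `0, 1, 2, …`: independent draws from the
prior. -/
def Population.meansLaw (S : Population) : Measure (ℕ → I) :=
  Measure.infinitePi fun _ : ℕ ↦ S.prior

instance (S : Population) : IsProbabilityMeasure S.meansLaw := by
  unfold Population.meansLaw; infer_instance

/-- The law of the table of rewards given the expected rewards `θ` of the arms. The entry `(a, t)`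
is the reward of the sample number `t` (counted from zero) of arm `a`. Given `θ`, the entries are
independent across arms and across samples, and the entry `(a, t)` has law `reward (θ a)`. -/
def Population.rewardsLaw (S : Population) : Kernel (ℕ → I) (ℕ × ℕ → I) where
  toFun θ := Measure.infinitePi fun p : ℕ × ℕ ↦ S.reward (θ p.1)
  measurable' := by
    refine Measurable.measure_of_isPiSystem_of_isProbabilityMeasure
      generateFrom_squareCylinders.symm
      (isPiSystem_squareCylinders (fun _ ↦ MeasurableSpace.isPiSystem_measurableSet) (by simp)) ?_
    rintro _ ⟨s, t, ht, rfl⟩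
    simp only [Set.mem_pi, Set.mem_univ, Set.mem_ofPred_eq, forall_const] at ht
    simp_rw [Measure.infinitePi_pi (fun p : ℕ × ℕ ↦ S.reward _) (fun i _ ↦ ht i)]
    exact Finset.measurable_prod _ fun p _ ↦
      (S.reward.measurable_coe (ht p)).comp (measurable_pi_apply p.1)

instance (S : Population) : IsMarkovKernel S.rewardsLaw :=
  ⟨fun θ ↦ inferInstanceAs
    (IsProbabilityMeasure (Measure.infinitePi fun p : ℕ × ℕ ↦ S.reward (θ p.1)))⟩

/-- The observations of the first `n` samples: which arm was sampled, and its reward. -/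
abbrev History (n : ℕ) : Type := Fin n → ℕ × I

/-- An adaptive, possibly randomized algorithm that tries to return `k` arms. Its private random
seed takes values in `U`. Arms are named by natural numbers; since the arms are exchangeable,
drawing a new arm from the population means using a name that has not been used before.
The decisions after `n` samples depend only on the seed and on the observations so far. -/
structure Algorithm (U : Type*) [MeasurableSpace U] (k : ℕ) where
  /-- the arm to be sampled next, if the algorithm does not stop -/
  sample : (n : ℕ) → U × History n → ℕ
  measurable_sample : ∀ n, Measurable (sample n)
  /-- the situations in which the algorithm stops -/
  halting : (n : ℕ) → Set (U × History n)
  measurableSet_halting : ∀ n, MeasurableSet (halting n)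
  /-- the arms that are returned, if the algorithm stops -/
  output : (n : ℕ) → U × History n → (Fin k → ℕ)
  measurable_output : ∀ n, Measurable (output n)

namespace Algorithm

variable {U : Type*} [MeasurableSpace U] {k : ℕ}

/-- The history after `n` samples, when the seed is `u` and the rewards are read off the table `r`:
a sample of an arm that has already been sampled `t` times shows the entry number `t` of the row of
this arm. (Stopping is accounted for in `numSamples`.) -/
def history (A : Algorithm U k) (u : U) (r : ℕ × ℕ → I) : (n : ℕ) → History n
  | 0 => Fin.elim0
  | n + 1 =>
    let h := A.history u r n
    let a := A.sample n (u, h)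
    Fin.snoc h (a, r (a, Fintype.card {i : Fin n // (h i).1 = a}))

/-- The number of samples taken until the algorithm stops (`⊤` if it never stops). -/
def numSamples (A : Algorithm U k) (u : U) (r : ℕ × ℕ → I) : ℕ∞ :=
  ⨅ (n : ℕ) (_ : (u, A.history u r n) ∈ A.halting n), (n : ℕ∞)

/-- The algorithm stops and returns `k` distinct arms, each of which has an expected reward of
at least `v`; here `θ` lists the expected rewards. -/
def Succeeds (A : Algorithm U k) (v : ℝ) (u : U) (θ : ℕ → I) (r : ℕ × ℕ → I) : Prop :=
  ∃ n : ℕ, A.numSamples u r = n ∧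
    Function.Injective (A.output n (u, A.history u r n)) ∧
    ∀ i, v ≤ (θ (A.output n (u, A.history u r n) i) : ℝ)

end Algorithm

/-- The joint law of the seed, the expected rewards and the table of rewards: the seed is
independent of the arms. -/
def Population.law (S : Population) {U : Type*} [MeasurableSpace U] (P : Measure U) :
    Measure (U × ((ℕ → I) × (ℕ × ℕ → I))) :=
  P.prod (S.meansLaw.compProd S.rewardsLaw)

instance (S : Population) {U : Type*} [MeasurableSpace U] (P : Measure U)
    [IsProbabilityMeasure P] : IsProbabilityMeasure (S.law P) := by
  unfold Population.law; infer_instance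

/-- The probability that the algorithm fails to return `k` distinct `[ε, ρ]`-optimal arms, i.e.
arms with expected reward at least `λ_ρ - ε`. -/
def Population.errorProb (S : Population) {U : Type*} [MeasurableSpace U] (P : Measure U) {k : ℕ}
    (A : Algorithm U k) (ε ρ : ℝ) : ℝ≥0∞ :=
  S.law P {ω | ¬ A.Succeeds (S.threshold ρ - ε) ω.1 ω.2.1 ω.2.2}

/-- The expected number of samples taken by the algorithm. -/
def Population.expectedSamples (S : Population) {U : Type*} [MeasurableSpace U] (P : Measure U)
    {k : ℕ} (A : Algorithm U k) : ℝ≥0∞ :=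
  ∫⁻ ω, ((A.numSamples ω.1 ω.2.2 : ℕ∞) : ℝ≥0∞) ∂(S.law P)

end QuantileBandit

end

/-!
The instance is a population of Bernoulli arms: an arm is good, with mean `1/2 + ε`, with
probability `ρ`, and bad, with mean `1/2 - ε`, otherwise. The threshold is `1/2 + ε`, so the
`[ε, ρ]`-optimal arms are those of mean at least `1/2`, which are the good ones.

The lower bound is a potential argument for the posterior probabilities `p_a` that the arms are
good. With `φ t = t - 1 - log t ≥ 0` let `Φ p = φ (p / ρ) + φ ((1 - p) / (1 - ρ))`. It vanishes at
the prior probability `ρ`, and its drift under one Bernoulli sample is a sum of two relative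
entropies between Bernoulli laws whose means differ by at most `2ε`, hence at most `64 ε²`
(`potential_step`). By optional stopping (`sum_stopped_le`), the expected value of `∑ a, Φ p_a` at
the stopping time is at most `64 ε² E[N]`.

Given the history and the seed, the means of the arms remain independent, so that the returned
distinct arms are all good with conditional probability `s = ∏ p_a`. If `s ≥ 1 - 2δ`, then every
returned arm contributes order `1 / ρ` through the first summand of `Φ`, and the second summands,
about `-log (1 - p_a)` with `∑ (1 - p_a) ≤ 4δ`, contribute order `k log (k / δ)` by concavity of the
logarithm. So the total potential is at least `K`, of the order of `k (1 / ρ + log (k / δ))`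
(`le_sum_potential`). Therefore it is always at least `K (s - (1 - 2δ)) / (2δ)`. This bound is
linear in `s`, so that it can be averaged over histories (`success_tradeoff`) and over the seed
(`le_expectedSamples_bernoulliPopulation`); since `s` has mean at least `1 - δ`, this gives
`64 ε² E[N] ≥ K / 2`.

The averages over histories are finite sums: with `0`-`1` rewards and a fixed seed only finitely
many histories of each length are reachable. The occurrence of one of them is a cylinder event of
the table of rewards (`exists_cylinder`), and its joint probability with the means of the arms
follows from the independence of the arms (`compProd_history_eq`).
-/

noncomputable section

namespace QuantileBandit

/-! ### The potential of a posterior probability -/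

/-- The nonnegative convex function `t - 1 - log t`, the integrand of a relative entropy. -/
def entropyGap (t : ℝ) : ℝ := t - 1 - Real.log t

lemma entropyGap_nonneg {t : ℝ} (ht : 0 < t) : 0 ≤ entropyGap t := by
  have := Real.log_le_sub_one_of_pos ht
  unfold entropyGap; linarith

/-- The convex potential of a posterior probability `p` with prior probability `ρ`; it vanishes at
`p = ρ`. The first summand reaches the order `1 / ρ`, the second one is about `-log (1 - p)`. -/
def potential (ρ p : ℝ) : ℝ := entropyGap (p / ρ) + entropyGap ((1 - p) / (1 - ρ))

lemma potential_nonneg {ρ p : ℝ} (hρ : 0 < ρ) (hρ' : ρ < 1) (hp : 0 < p) (hp' : p < 1) :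
    0 ≤ potential ρ p :=
  add_nonneg (entropyGap_nonneg (by positivity))
    (entropyGap_nonneg (div_pos (by linarith) (by linarith)))

lemma potential_self {ρ : ℝ} (hρ : 0 < ρ) (hρ' : ρ < 1) : potential ρ ρ = 0 := by
  have h : 1 - ρ ≠ 0 := by linarith
  simp [potential, entropyGap, div_self hρ.ne', div_self h]

/-- If an outcome with predictive law `(m, m')` and likelihood `(v, v')` multiplies `t` by the ratio
of likelihood and predictive probability, then the mean of `entropyGap t` grows by the relative
entropy of `(m, m')` with respect to `(v, v')`, which the `χ²`-divergence bounds. -/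
lemma entropyGap_step {t v m v' m' ε : ℝ} (ht : 0 < t) (hv : 1 / 4 ≤ v) (hv' : 1 / 4 ≤ v')
    (hm : 0 < m) (hm' : 0 < m') (hvv : v + v' = 1) (hmm : m + m' = 1)
    (hd : (m - v) ^ 2 ≤ 4 * ε ^ 2) :
    m * entropyGap (t * v / m) + m' * entropyGap (t * v' / m') ≤ entropyGap t + 32 * ε ^ 2 := by
  have key : ∀ v m : ℝ, 1 / 4 ≤ v → 0 < m → (m - v) ^ 2 ≤ 4 * ε ^ 2 →
      m * entropyGap (t * v / m) ≤ t * v - v - m * Real.log t + 16 * ε ^ 2 := by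
    intro v m hv hm hd
    have hv0 : 0 < v := by linarith
    have h1 : Real.log (t * v / m) = Real.log t - Real.log (m / v) := by
      rw [Real.log_div (by positivity) hm.ne', Real.log_mul ht.ne' hv0.ne',
        Real.log_div hm.ne' hv0.ne']
      ring
    have h2 := mul_le_mul_of_nonneg_left
      (Real.log_le_sub_one_of_pos (show 0 < m / v by positivity)) hm.le
    have h3 : m * (t * v / m) = t * v := by field_simp
    have h4 : m * (m / v - 1) = (m - v) ^ 2 / v + m - v := by field_simp; ring
    have h5 : (m - v) ^ 2 / v ≤ 16 * ε ^ 2 := by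
      rw [div_le_iff₀ hv0]
      nlinarith [sq_nonneg ε]
    have h6 : m * entropyGap (t * v / m)
        = m * (t * v / m) - m - m * Real.log t + m * Real.log (m / v) := by
      unfold entropyGap; rw [h1]; ring
    rw [h6, h3]
    linarith
  have h1 := key v m hv hm hd
  have h2 := key v' m' hv' hm' (by
    have : m' - v' = -(m - v) := by linarith
    rw [this, neg_sq]; exact hd)
  have h3 : entropyGap t = t * (v + v') - (v + v')
      - (m + m') * Real.log t := by
    rw [hvv, hmm]; unfold entropyGap; ring
  rw [h3]
  linarith

/-- One Bernoulli sample of an arm whose mean is `1 / 2 + ε` with posterior probability `p` and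
`1 / 2 - ε` otherwise raises the potential by at most `64 ε²` in expectation. -/
lemma potential_step {ρ ε p : ℝ} (hρ : 0 < ρ) (hρ' : ρ < 1) (hε : 0 < ε) (hε' : ε < 1 / 4)
    (hp : 0 < p) (hp' : p < 1) {m m' : ℝ} (hm : m = p * (1 / 2 + ε) + (1 - p) * (1 / 2 - ε))
    (hm' : m' = p * (1 / 2 - ε) + (1 - p) * (1 / 2 + ε)) :
    m * potential ρ (p * (1 / 2 + ε) / m) + m' * potential ρ (p * (1 / 2 - ε) / m')
      ≤ potential ρ p + 64 * ε ^ 2 := by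
  have hm0 : 0 < m := by
    rw [hm]
    exact add_pos (mul_pos hp (by linarith)) (mul_pos (by linarith) (by linarith))
  have hm0' : 0 < m' := by
    rw [hm']
    exact add_pos (mul_pos hp (by linarith)) (mul_pos (by linarith) (by linarith))
  have hρ1 : 0 < 1 - ρ := by linarith
  have e1 : 1 - p * (1 / 2 + ε) / m = (1 - p) * (1 / 2 - ε) / m := by
    field_simp; rw [hm]; ring
  have e2 : 1 - p * (1 / 2 - ε) / m' = (1 - p) * (1 / 2 + ε) / m' := by
    field_simp; rw [hm']; ring
  have hsum : m + m' = 1 := by rw [hm, hm']; ring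
  have d1 : (m - (1 / 2 + ε)) ^ 2 ≤ 4 * ε ^ 2 := by
    have : m - (1 / 2 + ε) = -(2 * ε * (1 - p)) := by rw [hm]; ring
    rw [this]; nlinarith [mul_pos hε hε, mul_pos hp (show 0 < 2 - p by linarith),
      mul_pos (mul_pos hε hε) (mul_pos hp (show 0 < 2 - p by linarith))]
  have d2 : (m - (1 / 2 - ε)) ^ 2 ≤ 4 * ε ^ 2 := by
    have : m - (1 / 2 - ε) = 2 * ε * p := by rw [hm]; ring
    rw [this]; nlinarith [mul_pos hε hε, mul_pos (show 0 < 1 - p by linarith)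
      (show 0 < 1 + p by linarith), mul_pos (mul_pos hε hε) (mul_pos
      (show 0 < 1 - p by linarith) (show 0 < 1 + p by linarith))]
  have s1 := entropyGap_step (t := p / ρ) (ε := ε) (v := 1 / 2 + ε) (v' := 1 / 2 - ε)
    (by positivity) (by linarith) (by linarith) hm0 hm0' (by ring) hsum d1
  have s2 := entropyGap_step (t := (1 - p) / (1 - ρ)) (ε := ε) (v := 1 / 2 - ε)
    (v' := 1 / 2 + ε) (div_pos (by linarith) hρ1) (by linarith) (by linarith) hm0 hm0'
    (by ring) hsum d2
  unfold potential
  rw [e1, e2]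
  have r1 : ∀ a b c d : ℝ, a * b / c / d = a / d * b / c := fun a b c d ↦ by ring
  rw [r1 p, r1 p, r1 (1 - p), r1 (1 - p)]
  linarith

/-- If `k` arms with independent posteriors `p i` are simultaneously good with probability at least
`1 - 2δ`, then their total potential is of the order of `k (1 / ρ + log (k / δ))`. -/
lemma le_sum_potential {k : ℕ} (hk : 1 ≤ k) {ρ δ : ℝ} (hρ : 0 < ρ) (hρ' : ρ ≤ 1 / 2) (hδ : 0 < δ)
    (hδ' : δ < Real.exp (-8) / 40) {p : Fin k → ℝ} (hp : ∀ i, 0 < p i) (hp' : ∀ i, p i < 1)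
    (hprod : 1 - 2 * δ ≤ ∏ i, p i) :
    2 / 25 * (k * (1 / ρ + Real.log (k / δ))) ≤ ∑ i, potential ρ (p i) := by
  have hk0 : (0 : ℝ) < k := by exact_mod_cast hk
  have hδ40 : δ < 1 / 40 := by
    have : Real.exp (-8) < 1 := by simp
    linarith
  have hlog2 := Real.log_two_lt_d9
  -- the posterior probabilities of being bad add up to at most `4δ`
  have hq : ∑ i, (1 - p i) ≤ 4 * δ := by
    have h1 : Real.log (1 - 2 * δ) ≤ ∑ i, Real.log (p i) := by
      rw [← Real.log_prod (fun i _ ↦ (hp i).ne')]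
      exact Real.log_le_log (by linarith) hprod
    have h2 : ∑ i, (1 - p i) ≤ ∑ i, -Real.log (p i) := by
      refine Finset.sum_le_sum fun i _ ↦ ?_
      have := Real.log_le_sub_one_of_pos (hp i)
      linarith
    rw [Finset.sum_neg_distrib] at h2
    have h3 := Real.one_sub_inv_le_log_of_pos (show 0 < 1 - 2 * δ by linarith)
    have h4 : (1 - 2 * δ)⁻¹ ≤ 1 + 4 * δ := by
      rw [inv_le_iff_one_le_mul₀ (by linarith)]
      nlinarith
    linarith
  have hqi : ∀ i, 1 - p i ≤ 4 * δ := fun i ↦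
    (Finset.single_le_sum (f := fun i ↦ 1 - p i) (fun j _ ↦ by linarith [hp' j])
      (Finset.mem_univ i)).trans hq
  set L := Real.log (k / δ) with hL
  have hL8 : 8 ≤ L := by
    rw [hL, Real.le_log_iff_exp_le (by positivity), le_div_iff₀ hδ]
    have h1 : (1 : ℝ) ≤ k := by exact_mod_cast hk
    have h2 : Real.exp 8 * Real.exp (-8) = 1 := by rw [← Real.exp_add]; simp
    nlinarith [Real.exp_pos 8]
  have hL4 : Real.log (4 * δ / k) = 2 * Real.log 2 - L := by
    rw [hL, Real.log_div hk0.ne' hδ.ne', Real.log_div (by positivity) hk0.ne',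
      Real.log_mul (by norm_num) hδ.ne', show (4 : ℝ) = 2 ^ 2 by norm_num, Real.log_pow]
    push_cast; ring
  -- the tangent of the logarithm at the average `4δ / k` replaces Jensen's inequality
  have hpt : ∀ i, 2 / 25 / ρ + (L - 3 * Real.log 2 - (1 - p i) * (k / (4 * δ)))
      ≤ potential ρ (p i) := by
    intro i
    have hqpos : 0 < 1 - p i := by linarith [hp' i]
    have hpi : 9 / 10 ≤ p i := by linarith [hqi i]
    have g1 : 2 / 25 / ρ ≤ entropyGap (p i / ρ) := by
      have hr : 2 ≤ 1 / ρ := by rw [le_div_iff₀ hρ]; linarith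
      have ht : 9 / 10 * (1 / ρ) ≤ p i / ρ := by
        rw [div_eq_mul_one_div (p i)]; gcongr
      have h0 : 0 < p i / ρ := div_pos (hp i) hρ
      have h1 : Real.log (p i / ρ) = Real.log 2 + Real.log (p i / ρ / 2) := by
        rw [← Real.log_mul (by norm_num) (by positivity)]; congr 1; ring
      have h2 := Real.log_le_sub_one_of_pos (half_pos h0)
      have h3 : 2 / 25 / ρ = 2 / 25 * (1 / ρ) := by ring
      unfold entropyGap
      rw [h1, h3]
      linarith
    have g2 : L - 3 * Real.log 2 - (1 - p i) * (k / (4 * δ))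
        ≤ entropyGap ((1 - p i) / (1 - ρ)) := by
      have hρ1 : 0 < 1 - ρ := by linarith
      have h1 : Real.log ((1 - p i) / (1 - ρ)) ≤ Real.log (1 - p i) + Real.log 2 := by
        rw [← Real.log_mul hqpos.ne' (by norm_num)]
        apply Real.log_le_log (by positivity)
        rw [div_le_iff₀ hρ1]
        nlinarith
      have h2 : Real.log (1 - p i) = Real.log (4 * δ / k)
          + Real.log ((1 - p i) * (k / (4 * δ))) := by
        rw [← Real.log_mul (by positivity) (by positivity)]
        congr 1; field_simp
      have h3 := Real.log_le_sub_one_of_pos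
        (show 0 < (1 - p i) * (k / (4 * δ)) by positivity)
      have h4 : 0 ≤ (1 - p i) / (1 - ρ) := by positivity
      unfold entropyGap
      linarith
    unfold potential; linarith
  have hsum := Finset.sum_le_sum fun i (_ : i ∈ Finset.univ) ↦ hpt i
  simp only [Finset.sum_add_distrib, Finset.sum_sub_distrib, ← Finset.sum_mul, Finset.sum_const,
    Finset.card_univ, Fintype.card_fin, nsmul_eq_mul] at hsum hq
  have hk1 : (k * 1 - ∑ i, p i) * (k / (4 * δ)) ≤ k := by
    calc (k * 1 - ∑ i, p i) * (k / (4 * δ)) ≤ (4 * δ) * (k / (4 * δ)) := by gcongr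
      _ = k := by field_simp
  have hkL := mul_le_mul_of_nonneg_left hL8 hk0.le
  have hkl := mul_lt_mul_of_pos_left hlog2 hk0
  have : 2 / 25 * (k * (1 / ρ + L)) = k * (2 / 25 / ρ) + 2 / 25 * (k * L) := by ring
  rw [this]
  linarith

/-! ### Likelihoods and posterior probabilities of a history -/

/-- The weight of the outcome `y ∈ {0, 1}` under the Bernoulli law with mean `x`. -/
def bernoulliWeight (x : ℝ) (y : I) : ℝ := if y = 1 then x else 1 - x

/-- The likelihood of the `0`-`1` rewards of the arm `a` in the history `h`, if this arm has mean
`x`. -/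
def likelihood (x : ℝ) {n : ℕ} (h : History n) (a : ℕ) : ℝ :=
  ∏ i, if (h i).1 = a then bernoulliWeight x (h i).2 else 1

/-- The likelihood of the rewards of the arm `a` in the history `h`, if its mean is drawn from the
prior `ρ δ_{1/2+ε} + (1-ρ) δ_{1/2-ε}`. -/
def mixtureLikelihood (ρ ε : ℝ) {n : ℕ} (h : History n) (a : ℕ) : ℝ :=
  ρ * likelihood (1 / 2 + ε) h a + (1 - ρ) * likelihood (1 / 2 - ε) h a

/-- The posterior probability that the arm `a` has mean `1 / 2 + ε`, given the history `h`. -/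
def posterior (ρ ε : ℝ) {n : ℕ} (h : History n) (a : ℕ) : ℝ :=
  ρ * likelihood (1 / 2 + ε) h a / mixtureLikelihood ρ ε h a

/-- The probability of the rewards in the history `h`, if the finite set `T` contains all sampled
arms. -/
def historyWeight (ρ ε : ℝ) (T : Finset ℕ) {n : ℕ} (h : History n) : ℝ :=
  ∏ a ∈ T, mixtureLikelihood ρ ε h a

/-- The total potential of the arms in `T`, given the history `h`. -/
def totalPotential (ρ ε : ℝ) (T : Finset ℕ) {n : ℕ} (h : History n) : ℝ :=
  ∑ a ∈ T, potential ρ (posterior ρ ε h a)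

lemma likelihood_pos {x : ℝ} (hx : 0 < x) (hx' : x < 1) {n : ℕ} (h : History n) (a : ℕ) :
    0 < likelihood x h a := by
  refine Finset.prod_pos fun i _ ↦ ?_
  unfold bernoulliWeight
  split_ifs <;> linarith

lemma likelihood_snoc (x : ℝ) {n : ℕ} (h : History n) (b : ℕ) (y : I) (a : ℕ) :
    likelihood x (Fin.snoc h (b, y) : History (n + 1)) a
      = likelihood x h a * if b = a then bernoulliWeight x y else 1 := by
  simp [likelihood, Fin.prod_univ_castSucc]

lemma mixtureLikelihood_snoc_of_ne (ρ ε : ℝ) {n : ℕ} (h : History n) {b a : ℕ} (hab : b ≠ a)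
    (y : I) :
    mixtureLikelihood ρ ε (Fin.snoc h (b, y) : History (n + 1)) a = mixtureLikelihood ρ ε h a := by
  simp [mixtureLikelihood, likelihood_snoc, hab]

lemma posterior_snoc_of_ne (ρ ε : ℝ) {n : ℕ} (h : History n) {b a : ℕ} (hab : b ≠ a) (y : I) :
    posterior ρ ε (Fin.snoc h (b, y) : History (n + 1)) a = posterior ρ ε h a := by
  simp [posterior, mixtureLikelihood_snoc_of_ne _ _ _ hab, likelihood_snoc, hab]

section

variable {ρ ε : ℝ} (hρ : 0 < ρ) (hρ' : ρ < 1) (hε : 0 < ε) (hε' : ε < 1 / 4)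

include hρ hρ' hε hε'

lemma mixtureLikelihood_pos {n : ℕ} (h : History n) (a : ℕ) : 0 < mixtureLikelihood ρ ε h a :=
  add_pos (mul_pos hρ (likelihood_pos (by linarith) (by linarith) h a))
    (mul_pos (by linarith) (likelihood_pos (by linarith) (by linarith) h a))

lemma posterior_pos {n : ℕ} (h : History n) (a : ℕ) : 0 < posterior ρ ε h a :=
  div_pos (mul_pos hρ (likelihood_pos (by linarith) (by linarith) h a))
    (mixtureLikelihood_pos hρ hρ' hε hε' h a)

lemma posterior_lt_one {n : ℕ} (h : History n) (a : ℕ) : posterior ρ ε h a < 1 := by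
  rw [posterior, div_lt_one (mixtureLikelihood_pos hρ hρ' hε hε' h a), mixtureLikelihood]
  have := mul_pos (show 0 < 1 - ρ by linarith)
    (likelihood_pos (x := 1 / 2 - ε) (by linarith) (by linarith) h a)
  linarith

lemma historyWeight_pos (T : Finset ℕ) {n : ℕ} (h : History n) : 0 < historyWeight ρ ε T h :=
  Finset.prod_pos fun a _ ↦ mixtureLikelihood_pos hρ hρ' hε hε' h a

lemma totalPotential_nonneg (T : Finset ℕ) {n : ℕ} (h : History n) :
    0 ≤ totalPotential ρ ε T h :=
  Finset.sum_nonneg fun a _ ↦ potential_nonneg hρ hρ' (posterior_pos hρ hρ' hε hε' h a)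
    (posterior_lt_one hρ hρ' hε hε' h a)

omit hρ hρ' hε hε' in
lemma totalPotential_snoc {T : Finset ℕ} {n : ℕ} (h : History n) {b : ℕ} (hb : b ∈ T) (y : I) :
    totalPotential ρ ε T (Fin.snoc h (b, y) : History (n + 1))
      = totalPotential ρ ε T h - potential ρ (posterior ρ ε h b)
        + potential ρ (posterior ρ ε (Fin.snoc h (b, y) : History (n + 1)) b) := by
  classical
  unfold totalPotential
  rw [← Finset.add_sum_erase _ _ hb, ← Finset.add_sum_erase (a := b) _ _ hb,
    Finset.sum_congr rfl fun a ha ↦ by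
      rw [posterior_snoc_of_ne _ _ _ (Finset.ne_of_mem_erase ha).symm]]
  ring

lemma mixtureLikelihood_snoc_self {n : ℕ} (h : History n) (b : ℕ) (y : I) :
    mixtureLikelihood ρ ε (Fin.snoc h (b, y) : History (n + 1)) b
      = mixtureLikelihood ρ ε h b * (posterior ρ ε h b * bernoulliWeight (1 / 2 + ε) y
        + (1 - posterior ρ ε h b) * bernoulliWeight (1 / 2 - ε) y) := by
  have h0 := (mixtureLikelihood_pos hρ hρ' hε hε' h b).ne'
  have h1 : mixtureLikelihood ρ ε h b * posterior ρ ε h b = ρ * likelihood (1 / 2 + ε) h b := by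
    rw [posterior]; field_simp
  have h2 : mixtureLikelihood ρ ε h b * (1 - posterior ρ ε h b)
      = (1 - ρ) * likelihood (1 / 2 - ε) h b := by
    rw [mul_sub, h1, mixtureLikelihood]; ring
  rw [mul_add, ← mul_assoc, ← mul_assoc, h1, h2]
  simp only [mixtureLikelihood, likelihood_snoc, if_true]
  ring

lemma posterior_snoc_self {n : ℕ} (h : History n) (b : ℕ) (y : I) :
    posterior ρ ε (Fin.snoc h (b, y) : History (n + 1)) b
      = posterior ρ ε h b * bernoulliWeight (1 / 2 + ε) y /
        (posterior ρ ε h b * bernoulliWeight (1 / 2 + ε) y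
          + (1 - posterior ρ ε h b) * bernoulliWeight (1 / 2 - ε) y) := by
  have h0 := (mixtureLikelihood_pos hρ hρ' hε hε' h b).ne'
  rw [posterior, mixtureLikelihood_snoc_self hρ hρ' hε hε', likelihood_snoc, if_pos rfl,
    ← div_div, posterior]
  congr 1
  ring

lemma historyWeight_snoc {T : Finset ℕ} {n : ℕ} (h : History n) {b : ℕ} (hb : b ∈ T) (y : I) :
    historyWeight ρ ε T (Fin.snoc h (b, y) : History (n + 1))
      = historyWeight ρ ε T h * (posterior ρ ε h b * bernoulliWeight (1 / 2 + ε) y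
        + (1 - posterior ρ ε h b) * bernoulliWeight (1 / 2 - ε) y) := by
  classical
  unfold historyWeight
  rw [← Finset.mul_prod_erase _ _ hb, ← Finset.mul_prod_erase (a := b) _ _ hb,
    Finset.prod_congr rfl fun a ha ↦ mixtureLikelihood_snoc_of_ne ρ ε h
      (Finset.ne_of_mem_erase ha).symm y, mixtureLikelihood_snoc_self hρ hρ' hε hε']
  ring

/-- The weights of the two continuations of a history add up to its weight. -/
lemma historyWeight_step {T : Finset ℕ} {n : ℕ} (h : History n) {b : ℕ} (hb : b ∈ T) :
    historyWeight ρ ε T (Fin.snoc h (b, 0) : History (n + 1))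
      + historyWeight ρ ε T (Fin.snoc h (b, 1) : History (n + 1)) = historyWeight ρ ε T h := by
  rw [historyWeight_snoc hρ hρ' hε hε' h hb, historyWeight_snoc hρ hρ' hε hε' h hb]
  simp only [bernoulliWeight, if_true, if_neg (zero_ne_one (α := I))]
  ring

/-- One sample raises the expected total potential by at most `64 ε²`. -/
lemma totalPotential_step {T : Finset ℕ} {n : ℕ} (h : History n) {b : ℕ} (hb : b ∈ T) :
    historyWeight ρ ε T (Fin.snoc h (b, 0) : History (n + 1))
        * totalPotential ρ ε T (Fin.snoc h (b, 0) : History (n + 1))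
      + historyWeight ρ ε T (Fin.snoc h (b, 1) : History (n + 1))
        * totalPotential ρ ε T (Fin.snoc h (b, 1) : History (n + 1))
      ≤ historyWeight ρ ε T h * totalPotential ρ ε T h
        + 64 * ε ^ 2 * historyWeight ρ ε T h := by
  have hs := potential_step hρ hρ' hε hε' (posterior_pos hρ hρ' hε hε' h b)
    (posterior_lt_one hρ hρ' hε hε' h b) rfl rfl
  have hZ := historyWeight_pos hρ hρ' hε hε' T h
  rw [historyWeight_snoc hρ hρ' hε hε' h hb, historyWeight_snoc hρ hρ' hε hε' h hb,
    totalPotential_snoc h hb, totalPotential_snoc h hb, posterior_snoc_self hρ hρ' hε hε',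
    posterior_snoc_self hρ hρ' hε hε']
  have e1 : 1 - (1 / 2 + ε) = 1 / 2 - ε := by ring
  have e2 : 1 - (1 / 2 - ε) = 1 / 2 + ε := by ring
  simp only [bernoulliWeight, if_true, if_neg (zero_ne_one (α := I)), e1, e2]
  have := mul_le_mul_of_nonneg_left hs hZ.le
  linarith

end

/-! ### Reachable histories -/

section Reachable

variable (sample : (n : ℕ) → History n → ℕ) (halt : (n : ℕ) → Set (History n))

open Classical in
/-- The histories of length `n` that a deterministic algorithm can produce without having stopped
earlier, if all rewards are `0` or `1`. -/
def reachable : (n : ℕ) → Finset (History n)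
  | 0 => {Fin.elim0}
  | n + 1 => (((reachable n).filter (· ∉ halt n)) ×ˢ ({0, 1} : Finset I)).image
      fun p ↦ Fin.snoc p.1 (sample n p.1, p.2)

open Classical in
/-- The histories after which the algorithm stops. -/
def stopped (n : ℕ) : Finset (History n) := (reachable sample halt n).filter (· ∈ halt n)

open Classical in
/-- The histories after which the algorithm takes another sample. -/
def alive (n : ℕ) : Finset (History n) := (reachable sample halt n).filter (· ∉ halt n)

variable {sample halt}

lemma mem_stopped {n : ℕ} {h : History n} :
    h ∈ stopped sample halt n ↔ h ∈ reachable sample halt n ∧ h ∈ halt n := by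
  simp [stopped]

lemma mem_alive {n : ℕ} {h : History n} :
    h ∈ alive sample halt n ↔ h ∈ reachable sample halt n ∧ h ∉ halt n := by
  simp [alive]

lemma mem_reachable_succ {n : ℕ} {h : History (n + 1)} :
    h ∈ reachable sample halt (n + 1) ↔ ∃ g ∈ alive sample halt n, ∃ y : I, (y = 0 ∨ y = 1) ∧
      h = (Fin.snoc g (sample n g, y) : History (n + 1)) := by
  simp only [reachable, Finset.mem_image, Finset.mem_product, Prod.exists, Finset.mem_insert,
    Finset.mem_singleton, alive]
  constructor
  · rintro ⟨g, y, ⟨hg, hy⟩, rfl⟩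
    exact ⟨g, hg, y, hy, rfl⟩
  · rintro ⟨g, hg, y, hy, rfl⟩
    exact ⟨g, y, ⟨hg, hy⟩, rfl⟩

lemma sum_reachable_succ (n : ℕ) (F : History (n + 1) → ℝ) :
    ∑ h ∈ reachable sample halt (n + 1), F h
      = ∑ h ∈ alive sample halt n, (F (Fin.snoc h (sample n h, 0))
        + F (Fin.snoc h (sample n h, 1))) := by
  classical
  rw [reachable, Finset.sum_image, Finset.sum_product]
  · refine Finset.sum_congr (by ext; simp [alive]) fun h _ ↦ ?_
    rw [Finset.sum_pair zero_ne_one]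
  · rintro ⟨h, y⟩ - ⟨h', y'⟩ - e
    obtain ⟨e1, e2⟩ := Fin.snoc_inj.1 e
    simp only [Prod.mk.injEq] at e2 ⊢
    exact ⟨e1, e2.2⟩

lemma sum_reachable (n : ℕ) (F : History n → ℝ) :
    ∑ h ∈ reachable sample halt n, F h
      = ∑ h ∈ stopped sample halt n, F h + ∑ h ∈ alive sample halt n, F h := by
  classical
  exact (Finset.sum_filter_add_sum_filter_not _ _ _).symm

/-- Optional stopping: if a weight on histories grows by at most `G` whenever a sample is taken,
then its total over the stopped histories is at most its initial value plus the total of `G`. -/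
lemma sum_stopped_le {F G : (n : ℕ) → History n → ℝ} {n : ℕ}
    (hF : ∀ j < n, ∀ h ∈ alive sample halt j,
      F (j + 1) (Fin.snoc h (sample j h, 0)) + F (j + 1) (Fin.snoc h (sample j h, 1))
        ≤ F j h + G j h) :
    ∑ j ∈ Finset.range n, ∑ h ∈ stopped sample halt j, F j h
        + ∑ h ∈ reachable sample halt n, F n h
      ≤ F 0 Fin.elim0 + ∑ j ∈ Finset.range n, ∑ h ∈ alive sample halt j, G j h := by
  induction n with
  | zero => simp [reachable]
  | succ n ih =>
    have h1 := ih fun j hj ↦ hF j (by omega)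
    have h2 := Finset.sum_le_sum (hF n (by omega))
    rw [Finset.sum_range_succ, Finset.sum_range_succ, sum_reachable_succ]
    rw [sum_reachable] at h1
    rw [Finset.sum_add_distrib (f := F n)] at h2
    linarith

/-- Up to a given time, a deterministic algorithm can sample or return only finitely many arms. -/
lemma exists_finset_arms {k : ℕ} (output : (n : ℕ) → History n → Fin k → ℕ) (n : ℕ) :
    ∃ T : Finset ℕ, ∀ j < n, ∀ h ∈ reachable sample halt j,
      sample j h ∈ T ∧ (∀ i, output j h i ∈ T) ∧ ∀ i, (h i).1 ∈ T := by
  classical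
  refine ⟨(Finset.range n).biUnion fun j ↦ (reachable sample halt j).biUnion fun h ↦
    {sample j h} ∪ Finset.univ.image (output j h) ∪ Finset.univ.image fun i ↦ (h i).1, ?_⟩
  intro j hj h hh
  simp only [Finset.mem_biUnion, Finset.mem_range, Finset.mem_union, Finset.mem_singleton,
    Finset.mem_image, Finset.mem_univ, true_and]
  exact ⟨⟨j, hj, h, hh, by simp⟩, fun i ↦ ⟨j, hj, h, hh, by simp⟩, fun i ↦ ⟨j, hj, h, hh, by simp⟩⟩

open Classical in
/-- The trade-off between the success probability of a deterministic algorithm within `n` steps and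
the expected number of samples, both written as sums over histories. The potential of a stopped
history is at least `K` as soon as the posterior success probability `s` exceeds `1 - 2δ`, hence
always at least `K (s - (1 - 2δ)) / (2δ)`, which is linear in `s`. -/
lemma success_tradeoff {k : ℕ} (hk : 1 ≤ k) {ρ ε δ : ℝ} (hρ : 0 < ρ) (hρ' : ρ ≤ 1 / 2)
    (hε : 0 < ε) (hε' : ε < 1 / 4) (hδ : 0 < δ) (hδ' : δ < Real.exp (-8) / 40)
    (output : (n : ℕ) → History n → Fin k → ℕ) {n : ℕ} {T : Finset ℕ}
    (hT : ∀ j < n, ∀ h ∈ reachable sample halt j, sample j h ∈ T ∧ ∀ i, output j h i ∈ T)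
    {K : ℝ} (hK : K = 2 / 25 * (k * (1 / ρ + Real.log (k / δ)))) (hK0 : 0 ≤ K) :
    K / (2 * δ) * ∑ j ∈ Finset.range n, ∑ h ∈ (stopped sample halt j).filter
          (fun h ↦ Function.Injective (output j h)),
        historyWeight ρ ε T h * ∏ i, posterior ρ ε h (output j h i)
      ≤ 64 * ε ^ 2 * ∑ j ∈ Finset.range n, ∑ h ∈ alive sample halt j, historyWeight ρ ε T h
        + K / (2 * δ) * (1 - 2 * δ) := by
  have hρ1 : ρ < 1 := by linarith
  have hδ1 : 0 ≤ 1 - 2 * δ := by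
    have : Real.exp (-8) < 1 := by simp
    linarith
  have hZ : ∀ {j : ℕ} (h : History j), 0 < historyWeight ρ ε T h :=
    fun h ↦ historyWeight_pos hρ hρ1 hε hε' T h
  have hM : ∀ {j : ℕ} (h : History j), 0 ≤ totalPotential ρ ε T h :=
    fun h ↦ totalPotential_nonneg hρ hρ1 hε hε' T h
  have hone : ∀ a, mixtureLikelihood ρ ε (Fin.elim0 : History 0) a = 1 := fun a ↦ by
    simp [mixtureLikelihood, likelihood]
  have A1 := sum_stopped_le (sample := sample) (halt := halt) (n := n)
    (F := fun _ h ↦ historyWeight ρ ε T h * totalPotential ρ ε T h)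
    (G := fun _ h ↦ 64 * ε ^ 2 * historyWeight ρ ε T h)
    fun j hj h hh ↦ totalPotential_step hρ hρ1 hε hε' h (hT j hj h (mem_alive.1 hh).1).1
  have A2 := sum_stopped_le (sample := sample) (halt := halt) (n := n)
    (F := fun _ h ↦ historyWeight ρ ε T h) (G := fun _ _ ↦ 0)
    fun j hj h hh ↦ by
      rw [add_zero]
      exact (historyWeight_step hρ hρ1 hε hε' h (hT j hj h (mem_alive.1 hh).1).1).le
  have A3 : 0 ≤ ∑ h ∈ reachable sample halt n, historyWeight ρ ε T h * totalPotential ρ ε T h :=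
    Finset.sum_nonneg fun h _ ↦ mul_nonneg (hZ h).le (hM h)
  have A4 : 0 ≤ ∑ h ∈ reachable sample halt n, historyWeight ρ ε T h :=
    Finset.sum_nonneg fun h _ ↦ (hZ h).le
  have A5 : totalPotential ρ ε T (Fin.elim0 : History 0) = 0 := by
    refine Finset.sum_eq_zero fun a _ ↦ ?_
    rw [posterior, hone]
    simp [likelihood, potential_self hρ hρ1]
  have A6 : historyWeight ρ ε T (Fin.elim0 : History 0) = 1 := by
    simp [historyWeight, hone]
  simp only [A5, A6, mul_zero, zero_add, Finset.sum_const_zero, add_zero] at A1 A2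
  -- the linear lower bound of the potential of a stopped history
  have key : ∀ j < n, ∀ h ∈ stopped sample halt j,
      K / (2 * δ) * (if Function.Injective (output j h) then
          historyWeight ρ ε T h * ∏ i, posterior ρ ε h (output j h i) else 0)
        ≤ historyWeight ρ ε T h * totalPotential ρ ε T h
          + K / (2 * δ) * (1 - 2 * δ) * historyWeight ρ ε T h := by
    intro j hj h hh
    have hc : 0 ≤ K / (2 * δ) := by positivity
    split_ifs with hinj
    · have hout : ∑ i, potential ρ (posterior ρ ε h (output j h i)) ≤ totalPotential ρ ε T h := by
        rw [← Finset.sum_image (s := Finset.univ) (g := output j h)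
          (f := fun a ↦ potential ρ (posterior ρ ε h a)) (hinj.injOn)]
        refine Finset.sum_le_sum_of_subset_of_nonneg ?_ fun a _ _ ↦ potential_nonneg hρ hρ1
          (posterior_pos hρ hρ1 hε hε' h a) (posterior_lt_one hρ hρ1 hε hε' h a)
        intro a ha
        obtain ⟨i, -, rfl⟩ := Finset.mem_image.1 ha
        exact (hT j hj h (mem_stopped.1 hh).1).2 i
      set s := ∏ i, posterior ρ ε h (output j h i) with hs
      have hs1 : s ≤ 1 := Finset.prod_le_one
        (fun i _ ↦ (posterior_pos hρ hρ1 hε hε' h _).le)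
        (fun i _ ↦ (posterior_lt_one hρ hρ1 hε hε' h _).le)
      have main : K / (2 * δ) * (s - (1 - 2 * δ)) ≤ totalPotential ρ ε T h := by
        by_cases hcase : 1 - 2 * δ ≤ s
        · have h1 := le_sum_potential hk hρ hρ' hδ hδ'
            (fun i ↦ posterior_pos hρ hρ1 hε hε' h (output j h i))
            (fun i ↦ posterior_lt_one hρ hρ1 hε hε' h (output j h i)) hcase
          rw [← hK] at h1
          calc K / (2 * δ) * (s - (1 - 2 * δ)) ≤ K / (2 * δ) * (2 * δ) := by
                gcongr; linarith
            _ = K := by field_simp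
            _ ≤ _ := h1.trans hout
        · exact (mul_nonpos_of_nonneg_of_nonpos hc (by linarith)).trans (hM h)
      have := mul_le_mul_of_nonneg_left main (hZ h).le
      linarith
    · rw [mul_zero]
      have := mul_nonneg (hZ h).le (hM h)
      have := hZ h
      positivity
  have B := Finset.sum_le_sum fun j (hj : j ∈ Finset.range n) ↦
    Finset.sum_le_sum (key j (Finset.mem_range.1 hj))
  simp only [Finset.sum_add_distrib, ← Finset.mul_sum, ← Finset.sum_filter] at B A1
  have C := mul_le_mul_of_nonneg_left (show ∑ j ∈ Finset.range n,
    ∑ h ∈ stopped sample halt j, historyWeight ρ ε T h ≤ 1 by linarith)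
    (show 0 ≤ K / (2 * δ) * (1 - 2 * δ) by positivity)
  linarith

end Reachable

/-! ### The two-point Bernoulli population -/

/-- The Bernoulli law with mean `x`, as a measure on `[0,1]`. -/
def bernoulliLaw (x : I) : Measure I :=
  ENNReal.ofReal x • Measure.dirac 1 + ENNReal.ofReal (1 - x) • Measure.dirac 0

lemma ofReal_add_ofReal_one_sub {x : ℝ} (h0 : 0 ≤ x) (h1 : x ≤ 1) :
    ENNReal.ofReal x + ENNReal.ofReal (1 - x) = 1 := by
  rw [← ENNReal.ofReal_add h0 (by linarith)]; simp

instance (x : I) : IsProbabilityMeasure (bernoulliLaw x) :=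
  ⟨by simpa [bernoulliLaw] using ofReal_add_ofReal_one_sub x.2.1 x.2.2⟩

lemma bernoulliLaw_singleton (x : I) {y : I} (hy : y = 0 ∨ y = 1) :
    bernoulliLaw x {y} = ENNReal.ofReal (bernoulliWeight x y) := by
  rcases hy with rfl | rfl <;> simp [bernoulliLaw, bernoulliWeight]

lemma ae_bernoulliLaw (x : I) : ∀ᵐ y ∂(bernoulliLaw x), y = 0 ∨ y = 1 := by
  rw [ae_iff]
  simp [bernoulliLaw]

/-- The Bernoulli laws as a kernel. -/
def bernoulliKernel : Kernel I I where
  toFun := bernoulliLaw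
  measurable' := by
    refine Measure.measurable_of_measurable_coe _ fun s hs ↦ ?_
    simp only [bernoulliLaw, Measure.coe_add, Measure.coe_smul, Pi.add_apply, Pi.smul_apply,
      smul_eq_mul]
    fun_prop

instance : IsMarkovKernel bernoulliKernel :=
  ⟨fun x ↦ inferInstanceAs (IsProbabilityMeasure (bernoulliLaw x))⟩

lemma integral_bernoulliLaw (x : I) : ∫ y, (y : ℝ) ∂(bernoulliLaw x) = x := by
  unfold bernoulliLaw
  rw [integral_add_measure, integral_smul_measure, integral_smul_measure, integral_dirac,
    integral_dirac]
  · simp [ENNReal.toReal_ofReal x.2.1]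
  · exact (integrable_dirac (by simp)).smul_measure ENNReal.ofReal_ne_top
  · exact (integrable_dirac (by simp)).smul_measure ENNReal.ofReal_ne_top

/-- The law of the expected rewards: `x` with probability `ρ`, and otherwise `x'`. -/
def twoPointLaw (ρ : ℝ) (x x' : I) : Measure I :=
  ENNReal.ofReal ρ • Measure.dirac x + ENNReal.ofReal (1 - ρ) • Measure.dirac x'

/-- The population of Bernoulli arms in which the fraction `ρ` of the arms has mean `1 / 2 + ε`
and the others have mean `1 / 2 - ε`. -/
def bernoulliPopulation (ρ ε : ℝ) (hρ : ρ ∈ I) (hε : 1 / 2 + ε ∈ I) (hε' : 1 / 2 - ε ∈ I) :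
    Population where
  prior := twoPointLaw ρ ⟨1 / 2 + ε, hε⟩ ⟨1 / 2 - ε, hε'⟩
  isProbabilityMeasure_prior :=
    ⟨by simpa [twoPointLaw] using ofReal_add_ofReal_one_sub hρ.1 hρ.2⟩
  reward := bernoulliKernel
  isMarkovKernel_reward := inferInstance
  mean_reward := integral_bernoulliLaw

lemma lintegral_twoPointLaw (ρ : ℝ) (x x' : I) {f : I → ℝ≥0∞} (hf : Measurable f) :
    ∫⁻ y, f y ∂(twoPointLaw ρ x x') = ENNReal.ofReal ρ * f x + ENNReal.ofReal (1 - ρ) * f x' := by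
  simp [twoPointLaw, lintegral_add_measure, lintegral_smul_measure, lintegral_dirac' _ hf]

section

variable {ρ ε : ℝ} {hI : ρ ∈ I} {hI1 : 1 / 2 + ε ∈ I} {hI2 : 1 / 2 - ε ∈ I}

lemma threshold_bernoulliPopulation (hρ : 0 < ρ) (hε : 0 < ε) :
    (bernoulliPopulation ρ ε hI hI1 hI2).threshold ρ = 1 / 2 + ε := by
  classical
  set S := bernoulliPopulation ρ ε hI hI1 hI2 with hS
  have : IsProbabilityMeasure (S.prior.map ((↑) : I → ℝ)) :=
    Measure.isProbabilityMeasure_map measurable_subtype_coe.aemeasurable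
  have hset : {x : ℝ | cdf (S.prior.map ((↑) : I → ℝ)) x ≤ 1 - ρ} = Set.Iio (1 / 2 + ε) := by
    ext x
    have h1 : cdf (S.prior.map ((↑) : I → ℝ)) x
        = (if 1 / 2 + ε ≤ x then ρ else 0) + (if 1 / 2 - ε ≤ x then 1 - ρ else 0) := by
      have hm : MeasurableSet ((↑) ⁻¹' Set.Iic x : Set I) :=
        measurable_subtype_coe measurableSet_Iic
      rw [cdf_eq_real, measureReal_def, Measure.map_apply measurable_subtype_coe measurableSet_Iic,
        hS]
      simp only [bernoulliPopulation, twoPointLaw, Measure.coe_add, Measure.coe_smul,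
        Pi.add_apply, Pi.smul_apply, smul_eq_mul, Measure.dirac_apply' _ hm, Set.indicator_apply,
        Set.mem_preimage, Set.mem_Iic, Pi.one_apply]
      have := hI.1
      have : 0 ≤ 1 - ρ := by linarith [hI.2]
      rw [ENNReal.toReal_add]
      · split_ifs <;> simp [ENNReal.toReal_ofReal, *]
      · split_ifs <;> simp
      · split_ifs <;> simp
    rw [Set.mem_ofPred_eq, h1, Set.mem_Iio]
    constructor
    · intro h
      by_contra! hx
      rw [if_pos hx, if_pos (by linarith)] at h
      linarith
    · intro h
      rw [if_neg h.not_ge]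
      have : 0 ≤ 1 - ρ := by linarith [hI.2]
      split_ifs <;> linarith
  rw [Population.threshold, Population.invCDF, hset, csSup_Iio]

end

/-! ### The law of a history -/

/-- The number of samples of the arm `a`, after one more sample. -/
lemma card_snoc {n : ℕ} (h : History n) (b : ℕ) (y : I) (a : ℕ) :
    Fintype.card {i : Fin (n + 1) // ((Fin.snoc h (b, y) : History (n + 1)) i).1 = a}
      = Fintype.card {i : Fin n // (h i).1 = a} + if b = a then 1 else 0 := by
  simp_rw [Fintype.card_subtype, Finset.card_filter, Fin.sum_univ_castSucc]
  simp only [Fin.snoc_castSucc, Fin.snoc_last]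

namespace Algorithm

variable {U : Type*} [MeasurableSpace U] {k : ℕ} (A : Algorithm U k) (u : U)

/-- The histories of length `n` that are reachable with the seed `u`. -/
abbrev reach (n : ℕ) : Finset (History n) :=
  reachable (fun n h ↦ A.sample n (u, h)) (fun n ↦ {h | (u, h) ∈ A.halting n}) n

/-- The histories of length `n` after which the algorithm stops, with the seed `u`. -/
abbrev stops (n : ℕ) : Finset (History n) :=
  stopped (fun n h ↦ A.sample n (u, h)) (fun n ↦ {h | (u, h) ∈ A.halting n}) n

/-- The histories of length `n` after which the algorithm goes on, with the seed `u`. -/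
abbrev continues (n : ℕ) : Finset (History n) :=
  alive (fun n h ↦ A.sample n (u, h)) (fun n ↦ {h | (u, h) ∈ A.halting n}) n

variable {A u}

lemma snd_eq_zero_or_one {n : ℕ} {h : History n} (hh : h ∈ A.reach u n) (i : Fin n) :
    (h i).2 = 0 ∨ (h i).2 = 1 := by
  induction n with
  | zero => exact i.elim0
  | succ n ih =>
    obtain ⟨g, hg, y, hy, rfl⟩ := mem_reachable_succ.1 hh
    refine Fin.lastCases ?_ (fun i ↦ ?_) i
    · simpa using hy
    · simpa using ih (mem_alive.1 hg).1 i

/-- The event that a given history occurs is a cylinder: it prescribes, for each arm, as many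
entries of the table as there are samples of this arm. -/
lemma exists_cylinder {n : ℕ} {h : History n} (hh : h ∈ A.reach u n) :
    ∃ (s : Finset (ℕ × ℕ)) (g : ℕ × ℕ → I),
      (∀ p, p ∈ s ↔ p.2 < Fintype.card {i : Fin n // (h i).1 = p.1}) ∧
      (∀ r, A.history u r n = h ↔ ∀ p ∈ s, r p = g p) ∧
      ∀ f : ℕ → I → ℝ≥0∞, ∏ p ∈ s, f p.1 (g p) = ∏ i, f (h i).1 (h i).2 := by
  classical
  induction n with
  | zero => exact ⟨∅, fun _ ↦ 0, by simp, fun r ↦ by simpa using Subsingleton.elim _ _, by simp⟩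
  | succ n ih =>
    obtain ⟨h', hh', y, -, rfl⟩ := mem_reachable_succ.1 hh
    obtain ⟨s, g, h1, h2, h3⟩ := ih (mem_alive.1 hh').1
    set a := A.sample n (u, h') with ha
    set q : ℕ × ℕ := (a, Fintype.card {i : Fin n // (h' i).1 = a}) with hq
    have hqs : q ∉ s := by simp [h1, hq]
    have hne : ∀ p ∈ s, p ≠ q := fun p hp e ↦ hqs (e ▸ hp)
    refine ⟨insert q s, Function.update g q y, fun p ↦ ?_, fun r ↦ ?_, fun f ↦ ?_⟩
    · rw [Finset.mem_insert, h1, card_snoc]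
      obtain ⟨b, t⟩ := p
      simp only [hq, Prod.mk.injEq]
      by_cases hab : a = b
      · subst hab
        simp only [true_and, if_true]
        omega
      · simp [hab, Ne.symm hab]
    · rw [Finset.forall_mem_insert, Function.update_self]
      have e1 : (∀ p ∈ s, r p = Function.update g q y p) ↔ ∀ p ∈ s, r p = g p :=
        forall₂_congr fun p hp ↦ by rw [Function.update_of_ne (hne p hp)]
      rw [e1, ← h2, Algorithm.history, Fin.snoc_inj]
      constructor
      · rintro ⟨e, e'⟩
        rw [e] at e'
        exact ⟨(Prod.mk.inj e').2, e⟩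
      · rintro ⟨e', e⟩
        rw [e]
        exact ⟨rfl, by rw [← e']⟩
    · rw [Finset.prod_insert hqs, Function.update_self, Fin.prod_univ_castSucc, ← Finset.prod_congr
        rfl fun p hp ↦ by rw [Function.update_of_ne (hne p hp)], h3]
      simp [hq, mul_comm]

lemma measurableSet_history_eq {n : ℕ} {h : History n} (hh : h ∈ A.reach u n) :
    MeasurableSet {r | A.history u r n = h} := by
  obtain ⟨s, g, -, h2, -⟩ := exists_cylinder hh
  simp only [h2, Set.ofPred_forall]
  exact Finset.measurableSet_biInter _ fun p _ ↦
    measurableSet_eq_fun (measurable_pi_apply p) measurable_const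

variable {ρ ε : ℝ} {hI : ρ ∈ I} {hI1 : 1 / 2 + ε ∈ I} {hI2 : 1 / 2 - ε ∈ I}

/-- The probability of a reachable history, given the means `θ` of the arms. -/
lemma rewardsLaw_history_eq {n : ℕ} {h : History n} (hh : h ∈ A.reach u n) (θ : ℕ → I) :
    (bernoulliPopulation ρ ε hI hI1 hI2).rewardsLaw θ {r | A.history u r n = h}
      = ∏ i, ENNReal.ofReal (bernoulliWeight (θ (h i).1) (h i).2) := by
  obtain ⟨s, g, -, h2, h3⟩ := exists_cylinder hh
  have hset : {r | A.history u r n = h} = Set.pi s fun p ↦ {g p} := by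
    ext r; simp [h2]
  change Measure.infinitePi (fun p : ℕ × ℕ ↦ bernoulliLaw (θ p.1)) _ = _
  rw [hset, Measure.infinitePi_pi _ fun p _ ↦ measurableSet_singleton _,
    h3 fun a y ↦ bernoulliLaw (θ a) {y}]
  exact Finset.prod_congr rfl fun i _ ↦ bernoulliLaw_singleton _ (snd_eq_zero_or_one hh i)

lemma measurable_likelihood {n : ℕ} (h : History n) (a : ℕ) :
    Measurable fun x : ℝ ↦ likelihood x h a := by
  unfold likelihood bernoulliWeight
  refine Finset.measurable_prod _ fun i _ ↦ ?_
  split_ifs <;> fun_prop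

/-- The joint probability of a history and of all arms in `R` being good. -/
lemma compProd_history_eq (hρ : 0 < ρ) (hρ' : ρ < 1) (hε : 0 < ε) (hε' : ε < 1 / 4) {n : ℕ}
    {h : History n} (hh : h ∈ A.reach u n) {T R : Finset ℕ} (hT : ∀ i, (h i).1 ∈ T) (hR : R ⊆ T) :
    ((bernoulliPopulation ρ ε hI hI1 hI2).meansLaw.compProd
        (bernoulliPopulation ρ ε hI hI1 hI2).rewardsLaw)
      {ω | A.history u ω.2 n = h ∧ ∀ a ∈ R, 1 / 2 ≤ (ω.1 a : ℝ)}
      = ENNReal.ofReal (historyWeight ρ ε T h * ∏ a ∈ R, posterior ρ ε h a) := by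
  classical
  set S := bernoulliPopulation ρ ε hI hI1 hI2 with hS
  have hmR : MeasurableSet {θ : ℕ → I | ∀ a ∈ R, 1 / 2 ≤ (θ a : ℝ)} := by
    simp only [Set.ofPred_forall]
    refine Finset.measurableSet_biInter _ fun a _ ↦ measurableSet_le measurable_const ?_
    fun_prop
  have hm : MeasurableSet {ω : (ℕ → I) × (ℕ × ℕ → I) |
      A.history u ω.2 n = h ∧ ∀ a ∈ R, 1 / 2 ≤ (ω.1 a : ℝ)} :=
    (measurable_snd (measurableSet_history_eq hh)).inter (measurable_fst hmR)
  -- the likelihood factors over the arms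
  let X : ℕ → I → ℝ≥0∞ := fun a x ↦
    if a ∈ R ∧ (x : ℝ) < 1 / 2 then 0 else ENNReal.ofReal (likelihood x h a)
  have hX : ∀ a, Measurable (X a) := fun a ↦ by
    refine Measurable.ite ?_ measurable_const
      ((measurable_likelihood h a).comp measurable_subtype_coe).ennreal_ofReal
    by_cases ha : a ∈ R
    · simpa [ha] using measurableSet_lt measurable_subtype_coe (measurable_const (a := (2 : ℝ)⁻¹))
    · simp [ha]
  have hfib : ∀ θ : ℕ → I, S.rewardsLaw θ (Prod.mk θ ⁻¹'
      {ω : (ℕ → I) × (ℕ × ℕ → I) | A.history u ω.2 n = h ∧ ∀ a ∈ R, 1 / 2 ≤ (ω.1 a : ℝ)})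
      = ∏ a ∈ T, X a (θ a) := by
    intro θ
    by_cases hθ : ∀ a ∈ R, 1 / 2 ≤ (θ a : ℝ)
    · have e : Prod.mk θ ⁻¹' {ω : (ℕ → I) × (ℕ × ℕ → I) |
          A.history u ω.2 n = h ∧ ∀ a ∈ R, 1 / 2 ≤ (ω.1 a : ℝ)} = {r | A.history u r n = h} := by
        ext r
        simp only [Set.mem_preimage, Set.mem_ofPred_eq]
        exact and_iff_left hθ
      have hnn : ∀ a, ∀ i, 0 ≤ if (h i).1 = a then bernoulliWeight (θ a) (h i).2 else 1 := by
        intro a i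
        unfold bernoulliWeight
        have := (θ a).2.1
        have := (θ a).2.2
        split_ifs <;> linarith
      rw [e, hS, rewardsLaw_history_eq hh]
      have e2 : ∏ a ∈ T, X a (θ a) = ∏ a ∈ T, ∏ i,
          if (h i).1 = a then ENNReal.ofReal (bernoulliWeight (θ a) (h i).2) else 1 := by
        refine Finset.prod_congr rfl fun a _ ↦ ?_
        have : ¬ (a ∈ R ∧ (θ a : ℝ) < 1 / 2) := fun h' ↦ absurd (hθ a h'.1) h'.2.not_ge
        simp only [X, if_neg this, likelihood]
        rw [ENNReal.ofReal_prod_of_nonneg fun i _ ↦ hnn a i]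
        refine Finset.prod_congr rfl fun i _ ↦ ?_
        split_ifs <;> simp
      rw [e2, Finset.prod_comm]
      refine Finset.prod_congr rfl fun i _ ↦ ?_
      rw [Finset.prod_ite_eq, if_pos (hT i)]
    · have e : Prod.mk θ ⁻¹' {ω : (ℕ → I) × (ℕ × ℕ → I) |
          A.history u ω.2 n = h ∧ ∀ a ∈ R, 1 / 2 ≤ (ω.1 a : ℝ)} = ∅ := by
        ext r
        simp only [Set.mem_preimage, Set.mem_ofPred_eq, Set.mem_empty_iff_false, iff_false]
        exact fun h' ↦ hθ h'.2
      push Not at hθ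
      obtain ⟨a, ha, ha'⟩ := hθ
      rw [e, measure_empty, Finset.prod_eq_zero (hR ha)]
      simp only [X]
      rw [if_pos ⟨ha, ha'⟩]
  rw [Measure.compProd_apply hm]
  simp_rw [hfib]
  have hind : iIndepFun (fun a (θ : ℕ → I) ↦ X a (θ a)) S.meansLaw :=
    iIndepFun_infinitePi (P := fun _ : ℕ ↦ S.prior) hX
  rw [lintegral_prod_eq_prod_lintegral_of_indepFun T _ hind
    fun a ↦ (hX a).comp (measurable_pi_apply a)]
  -- the integral over the mean of one arm
  have hone : ∀ a, ∫⁻ θ, X a (θ a) ∂S.meansLaw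
      = ENNReal.ofReal (mixtureLikelihood ρ ε h a * if a ∈ R then posterior ρ ε h a else 1) := by
    intro a
    have l1 := likelihood_pos (x := 1 / 2 + ε) (by linarith) (by linarith) h a
    have l2 := likelihood_pos (x := 1 / 2 - ε) (by linarith) (by linarith) h a
    have hmix := (mixtureLikelihood_pos hρ hρ' hε hε' h a).ne'
    have e1 : ∫⁻ θ, X a (θ a) ∂S.meansLaw = ∫⁻ x, X a x ∂S.prior :=
      (measurePreserving_eval_infinitePi (fun _ : ℕ ↦ S.prior) a).lintegral_comp (hX a)
    have e2 : S.prior = twoPointLaw ρ ⟨1 / 2 + ε, hI1⟩ ⟨1 / 2 - ε, hI2⟩ := rfl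
    have c1 : ¬ (a ∈ R ∧ 1 / 2 + ε < 1 / 2) := fun h' ↦ by linarith [h'.2]
    rw [e1, e2, lintegral_twoPointLaw _ _ _ (hX a)]
    simp only [X, if_neg c1]
    by_cases ha : a ∈ R
    · have c2 : a ∈ R ∧ 1 / 2 - ε < 1 / 2 := ⟨ha, by linarith⟩
      rw [if_pos c2, if_pos ha, mul_zero, add_zero, ← ENNReal.ofReal_mul hρ.le, posterior,
        mul_div_cancel₀ _ hmix]
    · have c2 : ¬ (a ∈ R ∧ 1 / 2 - ε < 1 / 2) := fun h' ↦ ha h'.1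
      have : 0 < 1 - ρ := by linarith
      rw [if_neg c2, if_neg ha, mul_one, ← ENNReal.ofReal_mul hρ.le, ← ENNReal.ofReal_mul this.le,
        ← ENNReal.ofReal_add (by positivity) (by positivity), mixtureLikelihood]
  rw [Finset.prod_congr rfl fun a _ ↦ hone a, ← ENNReal.ofReal_prod_of_nonneg,
    Finset.prod_mul_distrib, Finset.prod_ite_mem, Finset.inter_eq_right.2 hR, historyWeight]
  intro a _
  refine mul_nonneg (mixtureLikelihood_pos hρ hρ' hε hε' h a).le ?_
  split_ifs
  · exact (posterior_pos hρ hρ' hε hε' h a).le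
  · exact zero_le_one

end Algorithm

namespace Algorithm

variable {U : Type*} [MeasurableSpace U] {k : ℕ} {A : Algorithm U k} {u : U}

/-! ### The number of samples -/

/-- The algorithm takes at least `n` samples exactly if it does not stop earlier. -/
lemma natCast_le_numSamples {r : ℕ × ℕ → I} {n : ℕ} :
    (n : ℕ∞) ≤ A.numSamples u r ↔ ∀ i < n, (u, A.history u r i) ∉ A.halting i := by
  simp only [numSamples, le_iInf_iff, Nat.cast_le]
  exact forall_congr' fun i ↦ by rw [← not_lt, imp_not_comm]

lemma mem_halting_of_numSamples_eq {r : ℕ × ℕ → I} {n : ℕ} (h : A.numSamples u r = n) :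
    (u, A.history u r n) ∈ A.halting n := by
  by_contra hn
  have h1 := natCast_le_numSamples.1 h.ge
  have h2 : ((n + 1 : ℕ) : ℕ∞) ≤ A.numSamples u r := natCast_le_numSamples.2 fun i hi ↦ by
    rcases Nat.lt_succ_iff_lt_or_eq.1 hi with hi | rfl
    · exact h1 i hi
    · exact hn
  rw [h, Nat.cast_le] at h2
  omega

lemma natCast_le_numSamples_of_history_mem {r : ℕ × ℕ → I} {n : ℕ}
    (h : A.history u r n ∈ A.reach u n) : (n : ℕ∞) ≤ A.numSamples u r := by
  induction n with
  | zero => simp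
  | succ n ih =>
    obtain ⟨g, hg, y, -, e⟩ := mem_reachable_succ.1 h
    have e' : A.history u r n = g := by
      rw [history, Fin.snoc_inj] at e
      exact e.1
    rw [← e'] at hg
    have h1 := natCast_le_numSamples.1 (ih (mem_alive.1 hg).1)
    refine natCast_le_numSamples.2 fun i hi ↦ ?_
    rcases Nat.lt_succ_iff_lt_or_eq.1 hi with hi | rfl
    · exact h1 i hi
    · exact (mem_alive.1 hg).2

lemma history_mem_reach {r : ℕ × ℕ → I} (hr : ∀ p, r p = 0 ∨ r p = 1) {n : ℕ}
    (h : (n : ℕ∞) ≤ A.numSamples u r) : A.history u r n ∈ A.reach u n := by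
  induction n with
  | zero => simp [history, reachable]
  | succ n ih =>
    have h1 := natCast_le_numSamples.1 h
    have h2 := ih (natCast_le_numSamples.2 fun i hi ↦ h1 i (by omega))
    exact mem_reachable_succ.2 ⟨_, mem_alive.2 ⟨h2, h1 n (by omega)⟩, _, hr _, rfl⟩

lemma measurable_history (A : Algorithm U k) (n : ℕ) :
    Measurable fun ω : U × (ℕ × ℕ → I) ↦ A.history ω.1 ω.2 n := by
  classical
  induction n with
  | zero => exact measurable_pi_iff.2 fun i ↦ i.elim0
  | succ n ih =>
    have ha : Measurable fun ω : U × (ℕ × ℕ → I) ↦ A.sample n (ω.1, A.history ω.1 ω.2 n) :=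
      (A.measurable_sample n).comp (measurable_fst.prodMk ih)
    refine measurable_pi_iff.2 fun i ↦ Fin.lastCases ?_ (fun i ↦ ?_) i
    · simp only [history, Fin.snoc_last]
      have hc : Measurable fun ω : U × (ℕ × ℕ → I) ↦ Fintype.card {i : Fin n //
          (A.history ω.1 ω.2 n i).1 = A.sample n (ω.1, A.history ω.1 ω.2 n)} := by
        simp_rw [Fintype.card_subtype, Finset.card_filter]
        refine Finset.measurable_sum _ fun i _ ↦ Measurable.ite ?_ measurable_const
          measurable_const
        exact measurableSet_eq_fun (measurable_fst.comp ((measurable_pi_apply i).comp ih)) ha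
      have he : Measurable fun q : (ℕ × ℕ → I) × (ℕ × ℕ) ↦ q.1 q.2 :=
        measurable_from_prod_countable_left fun p ↦ measurable_pi_apply p
      exact ha.prodMk (he.comp (measurable_snd.prodMk (ha.prodMk hc)))
    · simp only [history, Fin.snoc_castSucc]
      exact (measurable_pi_apply i).comp ih

lemma measurable_numSamples (A : Algorithm U k) :
    Measurable fun ω : U × (ℕ × ℕ → I) ↦ ((A.numSamples ω.1 ω.2 : ℕ∞) : ℝ≥0∞) := by
  classical
  have : (fun ω : U × (ℕ × ℕ → I) ↦ ((A.numSamples ω.1 ω.2 : ℕ∞) : ℝ≥0∞))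
      = fun ω ↦ ⨅ n : ℕ, if (ω.1, A.history ω.1 ω.2 n) ∈ A.halting n then (n : ℝ≥0∞) else ⊤ := by
    ext ω
    simp only [numSamples, iInf_eq_if, ENat.toENNReal_iInf]
    refine iInf_congr fun n ↦ ?_
    split_ifs <;> simp
  rw [this]
  exact .iInf fun n ↦ Measurable.ite
    ((measurable_fst.prodMk (measurable_history A n)) (A.measurableSet_halting n))
    measurable_const measurable_const

/-! ### Success probability and expected number of samples for a fixed seed -/

variable {ρ ε : ℝ} {hI : ρ ∈ I} {hI1 : 1 / 2 + ε ∈ I} {hI2 : 1 / 2 - ε ∈ I}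

lemma ae_reward_eq_zero_or_one :
    ∀ᵐ ω ∂((bernoulliPopulation ρ ε hI hI1 hI2).meansLaw.compProd
      (bernoulliPopulation ρ ε hI hI1 hI2).rewardsLaw), ∀ p, ω.2 p = 0 ∨ ω.2 p = 1 := by
  have hm : MeasurableSet {ω : (ℕ → I) × (ℕ × ℕ → I) | ∀ p, ω.2 p = 0 ∨ ω.2 p = 1} := by
    rw [Set.ofPred_forall]
    refine MeasurableSet.iInter fun p ↦ ?_
    have h : Measurable fun ω : (ℕ → I) × (ℕ × ℕ → I) ↦ ω.2 p := by fun_prop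
    exact (measurableSet_eq_fun h measurable_const).union
      (measurableSet_eq_fun h measurable_const)
  refine (Measure.ae_compProd_iff hm).2 (ae_of_all _ fun θ ↦ ae_all_iff.2 fun p ↦ ?_)
  exact (measurePreserving_eval_infinitePi
    (fun p : ℕ × ℕ ↦ bernoulliLaw (θ p.1)) p).quasiMeasurePreserving.ae (ae_bernoulliLaw (θ p.1))

/-- The expected number of samples is at least the sum over the times `j < n` of the probability
that the algorithm goes on after `j` samples. -/
lemma sum_continues_le (hρ : 0 < ρ) (hρ' : ρ < 1) (hε : 0 < ε) (hε' : ε < 1 / 4) {n : ℕ}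
    {T : Finset ℕ}
    (hT : ∀ j < n, ∀ h ∈ A.reach u j, ∀ i, (h i).1 ∈ T) :
    ENNReal.ofReal (∑ j ∈ Finset.range n, ∑ h ∈ A.continues u j, historyWeight ρ ε T h)
      ≤ ∫⁻ ω, ((A.numSamples u ω.2 : ℕ∞) : ℝ≥0∞)
        ∂((bernoulliPopulation ρ ε hI hI1 hI2).meansLaw.compProd
          (bernoulliPopulation ρ ε hI hI1 hI2).rewardsLaw) := by
  classical
  set μ := (bernoulliPopulation ρ ε hI hI1 hI2).meansLaw.compProd
    (bernoulliPopulation ρ ε hI hI1 hI2).rewardsLaw with hμ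
  have hpos : ∀ {j : ℕ} (h : History j), 0 ≤ historyWeight ρ ε T h :=
    fun h ↦ (historyWeight_pos hρ hρ' hε hε' T h).le
  have hms : ∀ j, ∀ h ∈ A.continues u j,
      MeasurableSet {ω : (ℕ → I) × (ℕ × ℕ → I) | A.history u ω.2 j = h} := fun j h hh ↦
    measurable_snd (measurableSet_history_eq (mem_alive.1 hh).1)
  have e1 : ENNReal.ofReal (∑ j ∈ Finset.range n, ∑ h ∈ A.continues u j, historyWeight ρ ε T h)
      = ∑ j ∈ Finset.range n, ∑ h ∈ A.continues u j,
        ∫⁻ ω, {ω : (ℕ → I) × (ℕ × ℕ → I) | A.history u ω.2 j = h}.indicator 1 ω ∂μ := by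
    rw [ENNReal.ofReal_sum_of_nonneg fun j _ ↦ Finset.sum_nonneg fun h _ ↦ hpos h]
    refine Finset.sum_congr rfl fun j hj ↦ ?_
    rw [ENNReal.ofReal_sum_of_nonneg fun h _ ↦ hpos h]
    refine Finset.sum_congr rfl fun h hh ↦ ?_
    have hr := (mem_alive.1 hh).1
    have := compProd_history_eq (hI := hI) (hI1 := hI1) (hI2 := hI2) hρ hρ' hε hε' hr
      (hT j (Finset.mem_range.1 hj) h hr) (Finset.empty_subset T)
    rw [lintegral_indicator_one (hms j h hh)]
    simpa using this.symm
  rw [e1]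
  calc _ = ∫⁻ ω, ∑ j ∈ Finset.range n, ∑ h ∈ A.continues u j,
        {ω : (ℕ → I) × (ℕ × ℕ → I) | A.history u ω.2 j = h}.indicator 1 ω ∂μ := by
        rw [lintegral_finsetSum' _ fun j _ ↦ (Finset.measurable_sum _ fun h hh ↦
          measurable_one.indicator (hms j h hh)).aemeasurable]
        refine Finset.sum_congr rfl fun j _ ↦ ?_
        rw [lintegral_finsetSum' _ fun h hh ↦
          (measurable_one.indicator (hms j h hh)).aemeasurable]
    _ ≤ _ := by
        refine lintegral_mono fun ω ↦ ?_
        -- at each time at most one history occurs, and only at times before stopping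
        have hj : ∀ j ∈ Finset.range n, ∑ h ∈ A.continues u j,
            {ω : (ℕ → I) × (ℕ × ℕ → I) | A.history u ω.2 j = h}.indicator
              (1 : (ℕ → I) × (ℕ × ℕ → I) → ℝ≥0∞) ω
              ≤ if (j : ℕ∞) < A.numSamples u ω.2 then 1 else 0 := by
          intro j _
          simp only [Set.indicator_apply, Set.mem_ofPred_eq, Pi.one_apply, Finset.sum_ite_eq]
          split_ifs with h1 h2
          · exact le_rfl
          · refine absurd ?_ h2
            have h3 := natCast_le_numSamples_of_history_mem (mem_alive.1 h1).1
            refine lt_of_le_of_ne h3 fun e ↦ (mem_alive.1 h1).2 ?_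
            exact mem_halting_of_numSamples_eq e.symm
          · exact zero_le
          · exact le_rfl
        refine (Finset.sum_le_sum hj).trans ?_
        rw [Finset.sum_boole]
        rcases eq_or_ne (A.numSamples u ω.2) ⊤ with e | e
        · simp [e]
        · obtain ⟨m, hm⟩ := ENat.ne_top_iff_exists.1 e
          rw [← hm]
          simp only [Nat.cast_lt, ENat.toENNReal_coe, Nat.cast_le]
          calc _ ≤ (Finset.range m).card := Finset.card_le_card fun j hj ↦ by
                simpa using (Finset.mem_filter.1 hj).2
            _ = m := Finset.card_range m

open Classical in
/-- Up to a null event, success means that one of the reachable histories in which the algorithm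
stops and returns distinct arms occurs, and that these arms are good. -/
lemma compProd_succeeds_le :
    ((bernoulliPopulation ρ ε hI hI1 hI2).meansLaw.compProd
        (bernoulliPopulation ρ ε hI hI1 hI2).rewardsLaw)
      {ω | A.Succeeds (1 / 2) u ω.1 ω.2}
      ≤ ∑' n : ℕ, ∑ h ∈ (A.stops u n).filter (fun h ↦ Function.Injective (A.output n (u, h))),
        ((bernoulliPopulation ρ ε hI hI1 hI2).meansLaw.compProd
            (bernoulliPopulation ρ ε hI hI1 hI2).rewardsLaw)
          {ω | A.history u ω.2 n = h ∧
            ∀ a ∈ Finset.univ.image (A.output n (u, h)), 1 / 2 ≤ (ω.1 a : ℝ)} := by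
  set μ := (bernoulliPopulation ρ ε hI hI1 hI2).meansLaw.compProd
    (bernoulliPopulation ρ ε hI hI1 hI2).rewardsLaw with hμ
  refine le_trans (measure_mono_ae (t := ⋃ n : ℕ, ⋃ h ∈ (A.stops u n).filter
    (fun h ↦ Function.Injective (A.output n (u, h))), {ω | A.history u ω.2 n = h ∧
      ∀ a ∈ Finset.univ.image (A.output n (u, h)), 1 / 2 ≤ (ω.1 a : ℝ)}) ?_) ?_
  · filter_upwards [ae_reward_eq_zero_or_one (hI := hI) (hI1 := hI1) (hI2 := hI2)] with ω hω hs
    obtain ⟨n, hn, hinj, hgood⟩ := hs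
    refine Set.mem_iUnion.2 ⟨n, Set.mem_iUnion₂.2 ⟨A.history u ω.2 n, ?_, rfl, ?_⟩⟩
    · exact Finset.mem_filter.2 ⟨mem_stopped.2 ⟨history_mem_reach hω hn.ge,
        mem_halting_of_numSamples_eq hn⟩, hinj⟩
    · intro a ha
      obtain ⟨i, -, rfl⟩ := Finset.mem_image.1 ha
      exact hgood i
  · exact (measure_iUnion_le _).trans (ENNReal.tsum_le_tsum fun n ↦ measure_biUnion_finset_le _ _)

/-- The trade-off between the success probability and the expected number of samples for a fixed
seed of the algorithm. -/
lemma compProd_succeeds_tradeoff (hk : 1 ≤ k) {δ : ℝ} (hρ : 0 < ρ) (hρ' : ρ ≤ 1 / 2) (hε : 0 < ε)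
    (hε' : ε < 1 / 4) (hδ : 0 < δ) (hδ' : δ < Real.exp (-8) / 40) {K : ℝ}
    (hK : K = 2 / 25 * (k * (1 / ρ + Real.log (k / δ)))) (hK0 : 0 ≤ K) (u : U) :
    ENNReal.ofReal (K / (2 * δ)) * ((bernoulliPopulation ρ ε hI hI1 hI2).meansLaw.compProd
        (bernoulliPopulation ρ ε hI hI1 hI2).rewardsLaw) {ω | A.Succeeds (1 / 2) u ω.1 ω.2}
      ≤ ENNReal.ofReal (64 * ε ^ 2) * ∫⁻ ω, ((A.numSamples u ω.2 : ℕ∞) : ℝ≥0∞)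
          ∂((bernoulliPopulation ρ ε hI hI1 hI2).meansLaw.compProd
            (bernoulliPopulation ρ ε hI hI1 hI2).rewardsLaw)
        + ENNReal.ofReal (K / (2 * δ) * (1 - 2 * δ)) := by
  classical
  have hρ1 : ρ < 1 := by linarith
  have hδ1 : 0 ≤ 1 - 2 * δ := by
    have : Real.exp (-8) < 1 := by simp
    linarith
  have hc : 0 ≤ K / (2 * δ) := by positivity
  refine (mul_le_mul_right compProd_succeeds_le _).trans ?_
  rw [← ENNReal.tsum_mul_left]
  refine ENNReal.tsum_le_of_sum_range_le fun n ↦ ?_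
  obtain ⟨T, hT⟩ := exists_finset_arms (sample := fun n h ↦ A.sample n (u, h))
    (halt := fun n ↦ {h | (u, h) ∈ A.halting n}) (fun n h ↦ A.output n (u, h)) n
  have hpos : ∀ {j : ℕ} (h : History j), 0 ≤ historyWeight ρ ε T h :=
    fun h ↦ (historyWeight_pos hρ hρ1 hε hε' T h).le
  have hnn : ∀ {j : ℕ} (h : History j),
      0 ≤ historyWeight ρ ε T h * ∏ i, posterior ρ ε h (A.output j (u, h) i) := fun h ↦
    mul_nonneg (hpos h) (Finset.prod_nonneg fun i _ ↦ (posterior_pos hρ hρ1 hε hε' h _).le)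
  have h1 := success_tradeoff hk hρ hρ' hε hε' hδ hδ' (fun n h ↦ A.output n (u, h))
    (fun j hj h hh ↦ ⟨(hT j hj h hh).1, (hT j hj h hh).2.1⟩) hK hK0
  have h2 := sum_continues_le (A := A) (u := u) (hI := hI) (hI1 := hI1) (hI2 := hI2) hρ hρ1 hε hε'
    (fun j hj h hh ↦ (hT j hj h hh).2.2)
  have h3 : ∑ j ∈ Finset.range n, ENNReal.ofReal (K / (2 * δ)) *
        ∑ h ∈ (A.stops u j).filter (fun h ↦ Function.Injective (A.output j (u, h))),
          ((bernoulliPopulation ρ ε hI hI1 hI2).meansLaw.compProd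
            (bernoulliPopulation ρ ε hI hI1 hI2).rewardsLaw)
          {ω | A.history u ω.2 j = h ∧
            ∀ a ∈ Finset.univ.image (A.output j (u, h)), 1 / 2 ≤ (ω.1 a : ℝ)}
      = ENNReal.ofReal (K / (2 * δ) * ∑ j ∈ Finset.range n,
          ∑ h ∈ (A.stops u j).filter (fun h ↦ Function.Injective (A.output j (u, h))),
            historyWeight ρ ε T h * ∏ i, posterior ρ ε h (A.output j (u, h) i)) := by
    rw [← Finset.mul_sum, ENNReal.ofReal_mul hc, ENNReal.ofReal_sum_of_nonneg
      fun j _ ↦ Finset.sum_nonneg fun h _ ↦ hnn h]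
    congr 1
    refine Finset.sum_congr rfl fun j hj ↦ ?_
    rw [ENNReal.ofReal_sum_of_nonneg fun h _ ↦ hnn h]
    refine Finset.sum_congr rfl fun h hh ↦ ?_
    obtain ⟨hs, hinj⟩ := Finset.mem_filter.1 hh
    have hr := (mem_stopped.1 hs).1
    have hTj := hT j (Finset.mem_range.1 hj) h hr
    have hR : Finset.univ.image (A.output j (u, h)) ⊆ T := fun a ha ↦ by
      obtain ⟨i, -, rfl⟩ := Finset.mem_image.1 ha
      exact hTj.2.1 i
    rw [compProd_history_eq hρ hρ1 hε hε' hr hTj.2.2 hR, Finset.prod_image hinj.injOn]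
  rw [h3]
  refine (ENNReal.ofReal_le_ofReal h1).trans ?_
  rw [ENNReal.ofReal_add (mul_nonneg (by positivity) (Finset.sum_nonneg fun j _ ↦
    Finset.sum_nonneg fun h _ ↦ hpos h)) (by positivity), ENNReal.ofReal_mul (by positivity)]
  gcongr

end Algorithm

/-! ### The lower bound for the expected number of samples -/

/-- Averaging the trade-off over the seed: an algorithm with error probability at most `δ` has
`64 ε² E[N] ≥ K / 2`. -/
lemma le_expectedSamples_bernoulliPopulation {U : Type*} [MeasurableSpace U] (P : Measure U)
    [IsProbabilityMeasure P] {k : ℕ} (A : Algorithm U k) (hk : 1 ≤ k) {ρ ε δ : ℝ} (hρ : 0 < ρ)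
    (hρ' : ρ ≤ 1 / 2) (hε : 0 < ε) (hε' : ε < 1 / 4) (hδ : 0 < δ) (hδ' : δ < Real.exp (-8) / 40)
    {hI : ρ ∈ I} {hI1 : 1 / 2 + ε ∈ I} {hI2 : 1 / 2 - ε ∈ I} {K : ℝ}
    (hK : K = 2 / 25 * (k * (1 / ρ + Real.log (k / δ)))) (hK0 : 0 ≤ K)
    (herr : (bernoulliPopulation ρ ε hI hI1 hI2).errorProb P A ε ρ ≤ ENNReal.ofReal δ) :
    ENNReal.ofReal (K / 2) ≤ ENNReal.ofReal (64 * ε ^ 2) *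
      (bernoulliPopulation ρ ε hI hI1 hI2).expectedSamples P A := by
  set S := bernoulliPopulation ρ ε hI hI1 hI2 with hS
  have hδ1 : 0 ≤ 1 - 2 * δ := by
    have : Real.exp (-8) < 1 := by simp
    linarith
  have hc : 0 ≤ K / (2 * δ) := by positivity
  set μ := S.meansLaw.compProd S.rewardsLaw with hμ
  set G : Set (U × ((ℕ → I) × (ℕ × ℕ → I))) := {ω | A.Succeeds (1 / 2) ω.1 ω.2.1 ω.2.2} with hG
  -- a measurable superset of the failure event has measurable sections
  have hsucc : ENNReal.ofReal (1 - δ) ≤ ∫⁻ u, μ {ω | A.Succeeds (1 / 2) u ω.1 ω.2} ∂P := by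
    set t := toMeasurable (P.prod μ) Gᶜ with ht
    have htm : MeasurableSet t := measurableSet_toMeasurable _ _
    have h1 : (P.prod μ) t ≤ ENNReal.ofReal δ := by
      have e : S.errorProb P A ε ρ = (P.prod μ) Gᶜ := by
        rw [Population.errorProb, hS, threshold_bernoulliPopulation hρ hε, add_sub_cancel_right]
        rfl
      rwa [ht, measure_toMeasurable, ← e]
    calc ENNReal.ofReal (1 - δ) ≤ (P.prod μ) tᶜ := by
          rw [ENNReal.ofReal_sub _ hδ.le, ENNReal.ofReal_one, prob_compl_eq_one_sub htm]
          gcongr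
      _ = ∫⁻ u, μ (Prod.mk u ⁻¹' tᶜ) ∂P := Measure.prod_apply htm.compl
      _ ≤ _ := by
          refine lintegral_mono fun u ↦ measure_mono fun ω hω ↦ ?_
          by_contra hs
          exact hω (subset_toMeasurable _ _ hs)
  have hN : ∫⁻ u, ∫⁻ ω, ((A.numSamples u ω.2 : ℕ∞) : ℝ≥0∞) ∂μ ∂P = S.expectedSamples P A := by
    have hm : Measurable fun z : U × ((ℕ → I) × (ℕ × ℕ → I)) ↦
        ((A.numSamples z.1 z.2.2 : ℕ∞) : ℝ≥0∞) :=
      A.measurable_numSamples.comp (f := fun z : U × ((ℕ → I) × (ℕ × ℕ → I)) ↦ (z.1, z.2.2))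
        (measurable_fst.prodMk (measurable_snd.comp measurable_snd))
    exact (lintegral_prod _ hm.aemeasurable).symm
  have main : ENNReal.ofReal (K / (2 * δ)) * ENNReal.ofReal (1 - δ)
      ≤ ENNReal.ofReal (64 * ε ^ 2) * S.expectedSamples P A
        + ENNReal.ofReal (K / (2 * δ) * (1 - 2 * δ)) := by
    calc _ ≤ ENNReal.ofReal (K / (2 * δ)) * ∫⁻ u, μ {ω | A.Succeeds (1 / 2) u ω.1 ω.2} ∂P := by
          gcongr
      _ = ∫⁻ u, ENNReal.ofReal (K / (2 * δ)) * μ {ω | A.Succeeds (1 / 2) u ω.1 ω.2} ∂P :=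
          (lintegral_const_mul' _ _ ENNReal.ofReal_ne_top).symm
      _ ≤ ∫⁻ u, (ENNReal.ofReal (64 * ε ^ 2) * ∫⁻ ω, ((A.numSamples u ω.2 : ℕ∞) : ℝ≥0∞) ∂μ
            + ENNReal.ofReal (K / (2 * δ) * (1 - 2 * δ))) ∂P :=
          lintegral_mono fun u ↦ A.compProd_succeeds_tradeoff hk hρ hρ' hε hε' hδ hδ' hK hK0 u
      _ = _ := by
          rw [lintegral_add_right _ measurable_const, lintegral_const_mul' _ _
            ENNReal.ofReal_ne_top, hN]
          simp
  rw [← ENNReal.ofReal_mul hc] at main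
  have e : K / (2 * δ) * (1 - δ) = K / 2 + K / (2 * δ) * (1 - 2 * δ) := by field_simp; ring
  rw [e, ENNReal.ofReal_add (by positivity) (by positivity)] at main
  exact (ENNReal.add_le_add_iff_right ENNReal.ofReal_ne_top).1 main

end QuantileBandit

end

theorem mainTheorem2 :
    ∃ c : ℝ, 0 < c ∧
      ∀ (k : ℕ) (ρ ε δ : ℝ), 1 ≤ k → ρ ∈ Set.Ioc (0 : ℝ) (1 / 2) → ε ∈ Set.Ioo (0 : ℝ) (1 / 4) →
        δ ∈ Set.Ioo (0 : ℝ) (Real.exp (-8) / 40) →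
        ∃ S : QuantileBandit.Population,
          ∀ (U : Type*) [MeasurableSpace U] (P : MeasureTheory.Measure U)
            [MeasureTheory.IsProbabilityMeasure P] (A : QuantileBandit.Algorithm U k),
            S.errorProb P A ε ρ ≤ ENNReal.ofReal δ →
            ENNReal.ofReal (c * (k / ε ^ 2 * (1 / ρ + Real.log (k / δ)))) ≤
              S.expectedSamples P A := by
  -- the constant is `2 / 25` from the potential, divided by `2` and by `64` from the drift
  refine ⟨1 / 1600, by norm_num, ?_⟩
  rintro k ρ ε δ hk ⟨hρ, hρ'⟩ ⟨hε, hε'⟩ ⟨hδ, hδ'⟩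
  refine ⟨QuantileBandit.bernoulliPopulation ρ ε ⟨hρ.le, by linarith⟩
    ⟨by linarith, by linarith⟩ ⟨by linarith, by linarith⟩, ?_⟩
  intro U _ P _ A herr
  have hlog : 0 ≤ Real.log (k / δ) := by
    have h1 : (1 : ℝ) ≤ k := by exact_mod_cast hk
    have h2 : Real.exp (-8) < 1 := by simp
    exact Real.log_nonneg (by rw [le_div_iff₀ hδ]; linarith)
  have h := QuantileBandit.le_expectedSamples_bernoulliPopulation P A hk hρ hρ' hε hε' hδ hδ' rfl
    (by positivity) herr
  have e : 1 / 1600 * (k / ε ^ 2 * (1 / ρ + Real.log (k / δ)))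
      = 2 / 25 * (k * (1 / ρ + Real.log (k / δ))) / 2 / (64 * ε ^ 2) := by
    field_simp; norm_num
  rw [e, ENNReal.ofReal_div_of_pos (by positivity)]
  exact ENNReal.div_le_of_le_mul' h
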